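/- Let $S$ be a set of nonzero (not necessarily normalized), mutually orthogonal vectors (pure states) in $\mathbb{C}^2\otimes\mathbb{C}^2$. A (finite) measurement on one subsystem is a finite family of operators $M_x$ with $\sum_x M_x^\dagger M_x=\mathbb{I}$; it is called trivial if every POVM element $M_x^\dagger M_x$ is proportional to the identity, and orthogonality preserving for $S$ if for every outcome $x$ the vectors obtained by applying $M_x$ to that subsystem of the vectors of $S$ are mutually orthogonal. The set $S$ is called locally stable if, on each of the two subsystems, every orthogonality preserving measurement is trivial. It is called locally indistinguishable if no protocol of local operations and classical communication (finitely many rounds of local measurements by the two parties, each outcome being broadcast and each measurement allowed to depend on the earlier outcomes) identifies, with probability one, which element of $S$ was given. Then $$S \text{ is locally stable} \iff S \text{ is locally indistinguishable} \iff |S|\ge 3 \text{ and } S \text{ contains at least two entangled states},$$ where a state is entangled if it is not of the form $|u\rangle\otimes|v\rangle$. -/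

import Mathlib

open scoped Kronecker

namespace TwoQubit

/-- The space `ℂ^a ⊗ ℂ^b`, in the computational product basis `|i⟩|j⟩`. -/
abbrev Bipartite (a b : ℕ) : Type := EuclideanSpace ℂ (Fin a × Fin b)

/-- A vector is a product vector if it has the form `|u⟩ ⊗ |v⟩`. -/
def IsProduct {a b : ℕ} (ψ : Bipartite a b) : Prop :=
  ∃ (u : EuclideanSpace ℂ (Fin a)) (v : EuclideanSpace ℂ (Fin b)),
    ∀ i j, ψ (i, j) = u i * v j

/-- A vector is entangled if it is not a product vector. -/
def IsEntangled {a b : ℕ} (ψ : Bipartite a b) : Prop := ¬ IsProduct ψ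

/-- An orthogonal set of (not necessarily normalized) pure states: nonzero vectors, pairwise
orthogonal. -/
def IsOrthogonalSet {a b : ℕ} (S : Set (Bipartite a b)) : Prop :=
  (∀ ψ ∈ S, ψ ≠ 0) ∧ ∀ ψ ∈ S, ∀ φ ∈ S, ψ ≠ φ → inner ℂ ψ φ = 0

/-- A quantum measurement on `ℂ^d` with finitely many outcomes, given by its measurement
operators `M_x : ℂ^d → ℂ^(d_x)` with `∑ M_x† M_x = 1`.  The dimension after the measurement may
depend on the outcome, so that the use of local ancillas is included. -/
structure Measurement (d : ℕ) where
  /-- number of outcomes -/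
  numOutcomes : ℕ
  /-- dimension of the system after outcome `x` -/
  outDim : Fin numOutcomes → ℕ
  /-- the measurement operator `M_x` -/
  op : (x : Fin numOutcomes) → Matrix (Fin (outDim x)) (Fin d) ℂ
  complete : ∑ x, (op x).conjTranspose * op x = 1

/-- The POVM element `E_x = M_x† M_x`. -/
def Measurement.povm {d : ℕ} (m : Measurement d) (x : Fin m.numOutcomes) :
    Matrix (Fin d) (Fin d) ℂ :=
  (m.op x).conjTranspose * m.op x

/-- A measurement is trivial if all its POVM elements are proportional to the identity. -/
def Measurement.IsTrivial {d : ℕ} (m : Measurement d) : Prop :=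
  ∀ x, ∃ c : ℂ, m.povm x = c • (1 : Matrix (Fin d) (Fin d) ℂ)

/-- The vector `(M ⊗ 1) ψ`. -/
noncomputable def actA {a a' b : ℕ} (M : Matrix (Fin a') (Fin a) ℂ) (ψ : Bipartite a b) :
    Bipartite a' b :=
  Matrix.toEuclideanLin (M ⊗ₖ (1 : Matrix (Fin b) (Fin b) ℂ)) ψ

/-- The vector `(1 ⊗ M) ψ`. -/
noncomputable def actB {a b b' : ℕ} (M : Matrix (Fin b') (Fin b) ℂ) (ψ : Bipartite a b) :
    Bipartite a b' :=
  Matrix.toEuclideanLin ((1 : Matrix (Fin a) (Fin a) ℂ) ⊗ₖ M) ψ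

/-- The measurement `m`, performed on the first subsystem, keeps the states in `S` mutually
orthogonal, whatever the outcome. -/
def PreservesOrthogonalityA {a b : ℕ} (m : Measurement a) (S : Set (Bipartite a b)) : Prop :=
  ∀ x, ∀ ψ ∈ S, ∀ φ ∈ S, ψ ≠ φ → inner ℂ (actA (m.op x) ψ) (actA (m.op x) φ) = 0

/-- The measurement `m`, performed on the second subsystem, keeps the states in `S` mutually
orthogonal, whatever the outcome. -/
def PreservesOrthogonalityB {a b : ℕ} (m : Measurement b) (S : Set (Bipartite a b)) : Prop :=
  ∀ x, ∀ ψ ∈ S, ∀ φ ∈ S, ψ ≠ φ → inner ℂ (actB (m.op x) ψ) (actB (m.op x) φ) = 0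

/-- Locally stable: on each of the two subsystems only trivial orthogonality preserving
measurements can be performed. -/
def LocallyStable {a b : ℕ} (S : Set (Bipartite a b)) : Prop :=
  (∀ m : Measurement a, PreservesOrthogonalityA m S → m.IsTrivial) ∧
  (∀ m : Measurement b, PreservesOrthogonalityB m S → m.IsTrivial)

/-- An LOCC protocol (finitely many rounds) on `ℂ^a ⊗ ℂ^b` which ends with the announcement of an
element of `L`.  At each stage either one announces a result, or Alice or Bob performs a
measurement on her or his current subsystem and broadcasts the outcome; the continuation may
depend on all outcomes so far. -/
inductive LOCCProtocol (L : Type) : ℕ → ℕ → Type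
  | announce {a b : ℕ} (g : L) : LOCCProtocol L a b
  | alice {a b : ℕ} (m : Measurement a)
      (next : (x : Fin m.numOutcomes) → LOCCProtocol L (m.outDim x) b) : LOCCProtocol L a b
  | bob {a b : ℕ} (m : Measurement b)
      (next : (x : Fin m.numOutcomes) → LOCCProtocol L a (m.outDim x)) : LOCCProtocol L a b

open Classical in
/-- `P.weight ψ g` is the probability that the protocol announces `g` on the normalized input
state `ψ / ‖ψ‖`, multiplied by `‖ψ‖ ^ 2`.  After outcome `x` of a measurement by Alice, the
unnormalized state is `(M_x ⊗ 1) ψ`, and its squared norm is the (scaled) probability of `x`. -/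
noncomputable def LOCCProtocol.weight {L : Type} :
    {a b : ℕ} → LOCCProtocol L a b → Bipartite a b → L → ℝ
  | _, _, .announce g', ψ, g => if g' = g then ‖ψ‖ ^ 2 else 0
  | _, _, .alice m next, ψ, g => ∑ x, (next x).weight (actA (m.op x) ψ) g
  | _, _, .bob m next, ψ, g => ∑ x, (next x).weight (actB (m.op x) ψ) g

/-- The states in `S` can be distinguished perfectly by LOCC: some protocol, on each input
`ψ ∈ S`, announces `ψ` with probability one. -/
def LocallyDistinguishable {a b : ℕ} (S : Set (Bipartite a b)) : Prop :=
  ∃ P : LOCCProtocol (Bipartite a b) a b, ∀ ψ ∈ S, P.weight ψ ψ = ‖ψ‖ ^ 2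

/-- The states in `S` cannot be distinguished perfectly by LOCC. -/
def LocallyIndistinguishable {a b : ℕ} (S : Set (Bipartite a b)) : Prop :=
  ¬ LocallyDistinguishable S

end TwoQubit

/-!
Write a vector of `ℂ² ⊗ ℂ²` through its components along an orthonormal basis `e` of Alice's
system; these are vectors of Bob's system, obtained by applying the row matrices `⟨e x|` (`bra`).
The inner product of two vectors is the sum of the inner products of their components.

*Two entangled states and a third one are locally stable*
(`exists_conjTranspose_mul_self_eq_smul_one`). If a POVM element of an orthogonality preserving
measurement had two different eigenvalues, the components along each of its eigenvectors would be
pairwise orthogonal. An entangled state has no vanishing component, and `ℂ²` does not contain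
three nonzero orthogonal vectors, so the third state would be zero.

*Locally stable sets are locally indistinguishable* (`LocallyStable.not_discriminates`). States
that a protocol identifies with certainty are orthogonal, so every measurement of a perfect
protocol preserves orthogonality after each outcome. Starting from a stable set, all measurements
are therefore trivial: they act on the states as multiples of isometries, and the protocol
learns nothing.

*All other sets are locally distinguishable.* Alice measures in a basis along which the components
of the states are pairwise orthogonal, and Bob then distinguishes the components
(`discriminable_of_bra`); or the same with the parties exchanged. For two states such a basis
exists because the numerical range of a traceless `2 × 2` matrix contains `0`
(`exists_quadratic_form_eq_zero`). If there are two product states and at most one entangled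
state, the basis is read off from the product states
(`discriminable_of_tensor_of_inner_eq_zero`).

A set with at most one element is not locally stable, so that stability implies the condition on
the number of states.
-/

namespace TwoQubit

open Matrix

/-! ### Local operators -/

theorem actA_apply {a a' b : ℕ} (M : Matrix (Fin a') (Fin a) ℂ) (ψ : Bipartite a b)
    (i : Fin a') (j : Fin b) : actA M ψ (i, j) = ∑ k, M i k * ψ (k, j) := by
  simp [actA, Matrix.toLpLin_apply, Matrix.mulVec, dotProduct, Fintype.sum_prod_type,
    Matrix.one_apply]

theorem actB_apply {a b b' : ℕ} (M : Matrix (Fin b') (Fin b) ℂ) (ψ : Bipartite a b)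
    (i : Fin a) (j : Fin b') : actB M ψ (i, j) = ∑ k, M j k * ψ (i, k) := by
  simp [actB, Matrix.toLpLin_apply, Matrix.mulVec, dotProduct, Fintype.sum_prod_type,
    Matrix.one_apply]

theorem inner_toEuclideanLin {ι κ : Type*} [Fintype ι] [Fintype κ] [DecidableEq ι]
    [DecidableEq κ] (K : Matrix κ ι ℂ) (ψ φ : EuclideanSpace ℂ ι) :
    inner ℂ (toEuclideanLin K ψ) (toEuclideanLin K φ)
      = inner ℂ ψ (toEuclideanLin (Kᴴ * K) φ) := by
  rw [← LinearMap.adjoint_inner_right, ← Matrix.toEuclideanLin_conjTranspose_eq_adjoint]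
  simp [Matrix.toLpLin_apply, Matrix.mulVec_mulVec]

theorem inner_actA {a a' b : ℕ} (M : Matrix (Fin a') (Fin a) ℂ) (ψ φ : Bipartite a b) :
    inner ℂ (actA M ψ) (actA M φ) = inner ℂ ψ (actA (Mᴴ * M) φ) := by
  rw [actA, actA, inner_toEuclideanLin, conjTranspose_kronecker, ← mul_kronecker_mul]
  simp [actA]

theorem inner_actB {a b b' : ℕ} (M : Matrix (Fin b') (Fin b) ℂ) (ψ φ : Bipartite a b) :
    inner ℂ (actB M ψ) (actB M φ) = inner ℂ ψ (actB (Mᴴ * M) φ) := by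
  rw [actB, actB, inner_toEuclideanLin, conjTranspose_kronecker, ← mul_kronecker_mul]
  simp [actB]

/-- The vector `(U ⊗ V) ψ`. -/
noncomputable def actAB {a a' b b' : ℕ} (U : Matrix (Fin a') (Fin a) ℂ)
    (V : Matrix (Fin b') (Fin b) ℂ) (ψ : Bipartite a b) : Bipartite a' b' :=
  toEuclideanLin (U ⊗ₖ V) ψ

theorem actA_actAB {a a' a'' b b' : ℕ} (M : Matrix (Fin a'') (Fin a') ℂ)
    (U : Matrix (Fin a') (Fin a) ℂ) (V : Matrix (Fin b') (Fin b) ℂ) (ψ : Bipartite a b) :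
    actA M (actAB U V ψ) = actAB (M * U) V ψ := by
  simp only [actA, actAB, toLpLin_apply, mulVec_mulVec, ← mul_kronecker_mul,
    Matrix.one_mul]

theorem actB_actAB {a a' b b' b'' : ℕ} (M : Matrix (Fin b'') (Fin b') ℂ)
    (U : Matrix (Fin a') (Fin a) ℂ) (V : Matrix (Fin b') (Fin b) ℂ) (ψ : Bipartite a b) :
    actB M (actAB U V ψ) = actAB U (M * V) ψ := by
  simp only [actB, actAB, toLpLin_apply, mulVec_mulVec, ← mul_kronecker_mul,
    Matrix.one_mul]

theorem inner_actAB_left {a a' b b' : ℕ} {U : Matrix (Fin a') (Fin a) ℂ}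
    {V : Matrix (Fin b') (Fin b) ℂ} {d : ℂ} (hV : Vᴴ * V = d • 1) (ψ φ : Bipartite a b) :
    inner ℂ (actAB U V ψ) (actAB U V φ) = d * inner ℂ (actA U ψ) (actA U φ) := by
  rw [actAB, actAB, inner_toEuclideanLin, conjTranspose_kronecker, ← mul_kronecker_mul, hV,
    inner_actA, kronecker_smul, actA]
  simp

theorem inner_actAB_right {a a' b b' : ℕ} {U : Matrix (Fin a') (Fin a) ℂ}
    {V : Matrix (Fin b') (Fin b) ℂ} {c : ℂ} (hU : Uᴴ * U = c • 1) (ψ φ : Bipartite a b) :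
    inner ℂ (actAB U V ψ) (actAB U V φ) = c * inner ℂ (actB V ψ) (actB V φ) := by
  rw [actAB, actAB, inner_toEuclideanLin, conjTranspose_kronecker, ← mul_kronecker_mul, hU,
    inner_actB, smul_kronecker, actB]
  simp

theorem actA_smul {a a' b : ℕ} (c : ℂ) (M : Matrix (Fin a') (Fin a) ℂ) (ψ : Bipartite a b) :
    actA (c • M) ψ = c • actA M ψ := by
  simp [actA, smul_kronecker]

theorem actB_smul {a b b' : ℕ} (c : ℂ) (M : Matrix (Fin b') (Fin b) ℂ) (ψ : Bipartite a b) :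
    actB (c • M) ψ = c • actB M ψ := by
  simp [actB, kronecker_smul]

theorem actA_sum {a a' b : ℕ} {ι : Type*} (s : Finset ι) (M : ι → Matrix (Fin a') (Fin a) ℂ)
    (ψ : Bipartite a b) : actA (∑ x ∈ s, M x) ψ = ∑ x ∈ s, actA (M x) ψ := by
  ext ⟨i, j⟩
  simp only [actA_apply, WithLp.ofLp_sum, Finset.sum_apply, Matrix.sum_apply, Finset.sum_mul]
  exact Finset.sum_comm

theorem actB_sum {a b b' : ℕ} {ι : Type*} (s : Finset ι) (M : ι → Matrix (Fin b') (Fin b) ℂ)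
    (ψ : Bipartite a b) : actB (∑ x ∈ s, M x) ψ = ∑ x ∈ s, actB (M x) ψ := by
  ext ⟨i, j⟩
  simp only [actB_apply, WithLp.ofLp_sum, Finset.sum_apply, Matrix.sum_apply, Finset.sum_mul]
  exact Finset.sum_comm

theorem actA_one {a b : ℕ} (ψ : Bipartite a b) : actA 1 ψ = ψ := by
  simp [actA]

theorem actB_one {a b : ℕ} (ψ : Bipartite a b) : actB 1 ψ = ψ := by
  simp [actB]

theorem actAB_one_one {a b : ℕ} (ψ : Bipartite a b) : actAB 1 1 ψ = ψ := by
  simp [actAB]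

theorem Measurement.sum_inner_actA {a b : ℕ} (m : Measurement a) (ψ φ : Bipartite a b) :
    ∑ x, inner ℂ (actA (m.op x) ψ) (actA (m.op x) φ) = inner ℂ ψ φ := by
  simp only [inner_actA]
  rw [← inner_sum, ← actA_sum, m.complete, actA_one]

theorem Measurement.sum_inner_actB {a b : ℕ} (m : Measurement b) (ψ φ : Bipartite a b) :
    ∑ x, inner ℂ (actB (m.op x) ψ) (actB (m.op x) φ) = inner ℂ ψ φ := by
  simp only [inner_actB]
  rw [← inner_sum, ← actB_sum, m.complete, actB_one]

theorem Measurement.sum_norm_actA_sq {a b : ℕ} (m : Measurement a) (ψ : Bipartite a b) :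
    ∑ x, ‖actA (m.op x) ψ‖ ^ 2 = ‖ψ‖ ^ 2 := by
  have h := m.sum_inner_actA ψ ψ
  simp only [inner_self_eq_norm_sq_to_K] at h
  exact_mod_cast h

theorem Measurement.sum_norm_actB_sq {a b : ℕ} (m : Measurement b) (ψ : Bipartite a b) :
    ∑ x, ‖actB (m.op x) ψ‖ ^ 2 = ‖ψ‖ ^ 2 := by
  have h := m.sum_inner_actB ψ ψ
  simp only [inner_self_eq_norm_sq_to_K] at h
  exact_mod_cast h

/-! ### Perfect discrimination by a protocol -/

theorem LOCCProtocol.weight_le {L : Type} {a b : ℕ} (P : LOCCProtocol L a b) :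
    ∀ (ψ : Bipartite a b) (g : L), P.weight ψ g ≤ ‖ψ‖ ^ 2 := by
  induction P with
  | announce g' =>
    intro ψ g
    rw [LOCCProtocol.weight]
    split_ifs
    · exact le_rfl
    · positivity
  | alice m next ih =>
    intro ψ g
    rw [LOCCProtocol.weight, ← m.sum_norm_actA_sq ψ]
    exact Finset.sum_le_sum fun x _ => ih x _ _
  | bob m next ih =>
    intro ψ g
    rw [LOCCProtocol.weight, ← m.sum_norm_actB_sq ψ]
    exact Finset.sum_le_sum fun x _ => ih x _ _

/-- Since the weight of an announcement is at most the squared norm, a protocol that is always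
right is right after every outcome of Alice's first measurement. -/
theorem LOCCProtocol.weight_alice_eq_iff {L : Type} {a b : ℕ} (m : Measurement a)
    (next : (x : Fin m.numOutcomes) → LOCCProtocol L (m.outDim x) b) (ψ : Bipartite a b) (g : L) :
    (LOCCProtocol.alice m next).weight ψ g = ‖ψ‖ ^ 2 ↔
      ∀ x, (next x).weight (actA (m.op x) ψ) g = ‖actA (m.op x) ψ‖ ^ 2 := by
  rw [LOCCProtocol.weight, ← m.sum_norm_actA_sq ψ,
    Finset.sum_eq_sum_iff_of_le fun x _ => (next x).weight_le _ _]
  simp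

theorem LOCCProtocol.weight_bob_eq_iff {L : Type} {a b : ℕ} (m : Measurement b)
    (next : (x : Fin m.numOutcomes) → LOCCProtocol L a (m.outDim x)) (ψ : Bipartite a b) (g : L) :
    (LOCCProtocol.bob m next).weight ψ g = ‖ψ‖ ^ 2 ↔
      ∀ x, (next x).weight (actB (m.op x) ψ) g = ‖actB (m.op x) ψ‖ ^ 2 := by
  rw [LOCCProtocol.weight, ← m.sum_norm_actB_sq ψ,
    Finset.sum_eq_sum_iff_of_le fun x _ => (next x).weight_le _ _]
  simp

/-- Vectors that a protocol tells apart with certainty are orthogonal. -/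
theorem LOCCProtocol.inner_eq_zero {L : Type} {a b : ℕ} (P : LOCCProtocol L a b) {g h : L}
    (hgh : g ≠ h) : ∀ {ψ φ : Bipartite a b}, P.weight ψ g = ‖ψ‖ ^ 2 → P.weight φ h = ‖φ‖ ^ 2 →
      inner ℂ ψ φ = 0 := by
  induction P with
  | announce g' =>
    intro ψ φ hψ hφ
    rw [LOCCProtocol.weight] at hψ hφ
    by_cases hg : g' = g
    · rw [if_neg (hg ▸ hgh)] at hφ
      have : φ = 0 := by simpa using hφ.symm
      simp [this]
    · rw [if_neg hg] at hψ
      have : ψ = 0 := by simpa using hψ.symm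
      simp [this]
  | alice m next ih =>
    intro ψ φ hψ hφ
    rw [weight_alice_eq_iff] at hψ hφ
    rw [← m.sum_inner_actA ψ φ]
    exact Finset.sum_eq_zero fun x _ => ih x (hψ x) (hφ x)
  | bob m next ih =>
    intro ψ φ hψ hφ
    rw [weight_bob_eq_iff] at hψ hφ
    rw [← m.sum_inner_actB ψ φ]
    exact Finset.sum_eq_zero fun x _ => ih x (hψ x) (hφ x)

/-! ### Locally stable sets are locally indistinguishable -/

/-- If `U` is a multiple of an isometry, then a measurement on the range of `U` gives one on its
domain, with measurement operators proportional to `M_x U`. If the latter is trivial, then some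
`M_x U` is a nonzero multiple of an isometry, as the POVM elements sum to `1`. -/
theorem Measurement.exists_comp {a d : ℕ} [NeZero d] (m : Measurement a)
    (U : Matrix (Fin a) (Fin d) ℂ) {c : ℂ} (hc : c ≠ 0) (hU : Uᴴ * U = c • 1) :
    ∃ (r : ℂ) (hcomp : ∑ x, (r • (m.op x * U))ᴴ * (r • (m.op x * U)) = 1),
      (Measurement.mk m.numOutcomes m.outDim (fun x => r • (m.op x * U)) hcomp).IsTrivial →
        ∃ x, ∃ c' : ℂ, c' ≠ 0 ∧ (m.op x * U)ᴴ * (m.op x * U) = c' • 1 := by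
  -- `c` is a diagonal entry of `Uᴴ * U`, hence a positive real
  have hcr : c = ((∑ k, ‖U k 0‖ ^ 2 : ℝ) : ℂ) := by
    have h := congrFun (congrFun hU 0) 0
    simp only [mul_apply, conjTranspose_apply, Matrix.smul_apply, one_apply_eq, smul_eq_mul,
      mul_one] at h
    rw [← h]
    push_cast
    exact Finset.sum_congr rfl fun k _ => by
      simpa using Complex.conj_mul' (U k 0)
  set t : ℝ := ∑ k, ‖U k 0‖ ^ 2 with ht
  have ht0 : 0 ≤ t := by positivity
  have htne : t ≠ 0 := by
    intro h
    exact hc (by rw [hcr, h]; simp)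
  have hsum : ∑ x, (m.op x * U)ᴴ * (m.op x * U) = c • 1 := by
    have : ∀ x, (m.op x * U)ᴴ * (m.op x * U) = Uᴴ * ((m.op x)ᴴ * m.op x) * U := by
      intro x
      simp only [conjTranspose_mul, Matrix.mul_assoc]
    simp only [this]
    rw [← Matrix.sum_mul, ← Matrix.mul_sum, m.complete, Matrix.mul_one, hU]
  let r : ℂ := ((Real.sqrt t)⁻¹ : ℝ)
  have hr : star r * r = c⁻¹ := by
    rw [hcr]
    simp only [r, Complex.star_def, Complex.conj_ofReal]
    rw [← Complex.ofReal_mul, ← mul_inv, Real.mul_self_sqrt ht0, Complex.ofReal_inv]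
  have hmul : ∀ x, (r • (m.op x * U))ᴴ * (r • (m.op x * U))
      = c⁻¹ • ((m.op x * U)ᴴ * (m.op x * U)) := by
    intro x
    rw [conjTranspose_smul, Matrix.smul_mul, Matrix.mul_smul, smul_smul, hr]
  refine ⟨r, ?_, ?_⟩
  · simp only [hmul]
    rw [← Finset.smul_sum, hsum, smul_smul, inv_mul_cancel₀ hc, one_smul]
  · intro htriv
    by_contra! hcon
    apply hc
    have hzero : ∀ x, (m.op x * U)ᴴ * (m.op x * U) = 0 := by
      intro x
      obtain ⟨e, he⟩ := htriv x
      change (r • (m.op x * U))ᴴ * (r • (m.op x * U)) = e • 1 at he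
      rw [hmul] at he
      have he' : (m.op x * U)ᴴ * (m.op x * U) = (c * e) • 1 := by
        rw [mul_smul, ← he, smul_smul, mul_inv_cancel₀ hc, one_smul]
      by_cases hce : c * e = 0
      · rw [he', hce, zero_smul]
      · exact absurd he' (hcon x _ hce)
    have h := congrFun (congrFun hsum 0) 0
    simp only [hzero, Finset.sum_const_zero] at h
    simpa using h.symm

/-- The induction behind local indistinguishability: as long as only trivial measurements were
made, the states in `S` have undergone `U ⊗ V` with `U` and `V` multiples of isometries. The next
measurement of a perfect protocol preserves orthogonality, so it is trivial as well, and some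
outcome does not annihilate the states. -/
theorem LocallyStable.not_discriminates {a₀ b₀ : ℕ} [NeZero a₀] [NeZero b₀]
    {S : Set (Bipartite a₀ b₀)} (hS : LocallyStable S) {ψ₁ ψ₂ : Bipartite a₀ b₀} (h₁ : ψ₁ ∈ S)
    (h₂ : ψ₂ ∈ S) (hne : ψ₁ ≠ ψ₂) (h₁0 : ψ₁ ≠ 0) (h₂0 : ψ₂ ≠ 0) {a b : ℕ}
    (P : LOCCProtocol (Bipartite a₀ b₀) a b) :
    ∀ (U : Matrix (Fin a) (Fin a₀) ℂ) (V : Matrix (Fin b) (Fin b₀) ℂ) (c d : ℂ), c ≠ 0 → d ≠ 0 →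
      Uᴴ * U = c • 1 → Vᴴ * V = d • 1 →
      ¬ ∀ ψ ∈ S, P.weight (actAB U V ψ) ψ = ‖actAB U V ψ‖ ^ 2 := by
  induction P with
  | announce g =>
    intro U V c d hc hd hU hV h
    have key : ∀ ψ ∈ S, ψ ≠ 0 → g = ψ := by
      intro ψ hψ hψ0
      by_contra hg
      have hw := h ψ hψ
      rw [LOCCProtocol.weight, if_neg hg] at hw
      have hz : actAB U V ψ = 0 := by simpa using hw.symm
      have hi := inner_actAB_left (U := U) hV ψ ψ
      rw [hz, inner_zero_left, inner_actA, hU, actA_smul, actA_one, inner_smul_right] at hi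
      simp [hc, hd, hψ0] at hi
    exact hne ((key ψ₁ h₁ h₁0).symm.trans (key ψ₂ h₂ h₂0))
  | alice m next ih =>
    intro U V c d hc hd hU hV h
    simp only [LOCCProtocol.weight_alice_eq_iff, actA_actAB] at h
    obtain ⟨r, hcomp, htriv⟩ := m.exists_comp U hc hU
    obtain ⟨x, c', hc', hx⟩ := htriv <| hS.1 _ <| by
      intro x ψ hψ φ hφ hψφ
      have h0 := (next x).inner_eq_zero hψφ (h ψ hψ x) (h φ hφ x)
      rw [inner_actAB_left hV] at h0
      simp [actA_smul, (mul_eq_zero.1 h0).resolve_left hd]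
    exact ih x _ V c' d hc' hd hx hV fun ψ hψ => h ψ hψ x
  | bob m next ih =>
    intro U V c d hc hd hU hV h
    simp only [LOCCProtocol.weight_bob_eq_iff, actB_actAB] at h
    obtain ⟨r, hcomp, htriv⟩ := m.exists_comp V hd hV
    obtain ⟨x, d', hd', hx⟩ := htriv <| hS.2 _ <| by
      intro x ψ hψ φ hφ hψφ
      have h0 := (next x).inner_eq_zero hψφ (h ψ hψ x) (h φ hφ x)
      rw [inner_actAB_right hU] at h0
      simp [actB_smul, (mul_eq_zero.1 h0).resolve_left hc]
    exact ih x U _ c d' hc hd' hU hx fun ψ hψ => h ψ hψ x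

theorem LocallyStable.locallyIndistinguishable {a b : ℕ} [NeZero a] [NeZero b]
    {S : Set (Bipartite a b)} (hS : LocallyStable S) (h0 : ∀ ψ ∈ S, ψ ≠ 0) (hnt : S.Nontrivial) :
    LocallyIndistinguishable S := by
  rintro ⟨P, hP⟩
  obtain ⟨ψ, hψ, φ, hφ, hne⟩ := hnt
  refine hS.not_discriminates hψ hφ hne (h0 ψ hψ) (h0 φ hφ) P 1 1 1 1 one_ne_zero one_ne_zero
    (by simp) (by simp) ?_
  simpa only [actAB_one_one] using hP

/-! ### Exchanging the two parties -/

/-- The vector with the two tensor factors exchanged. -/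
noncomputable def swap {a b : ℕ} (ψ : Bipartite a b) : Bipartite b a :=
  WithLp.toLp 2 fun p => ψ p.swap

theorem swap_apply {a b : ℕ} (ψ : Bipartite a b) (i : Fin b) (j : Fin a) :
    swap ψ (i, j) = ψ (j, i) := rfl

theorem swap_swap {a b : ℕ} (ψ : Bipartite a b) : swap (swap ψ) = ψ := rfl

theorem inner_eq_sum {a b : ℕ} (ψ φ : Bipartite a b) :
    inner ℂ ψ φ = ∑ i, ∑ j, star (ψ (i, j)) * φ (i, j) := by
  simp [PiLp.inner_apply, Fintype.sum_prod_type, mul_comm]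

theorem inner_swap_swap {a b : ℕ} (ψ φ : Bipartite a b) :
    inner ℂ (swap ψ) (swap φ) = inner ℂ ψ φ := by
  simp only [inner_eq_sum, swap_apply]
  exact Finset.sum_comm

theorem norm_swap {a b : ℕ} (ψ : Bipartite a b) : ‖swap ψ‖ = ‖ψ‖ := by
  rw [@norm_eq_sqrt_re_inner ℂ, @norm_eq_sqrt_re_inner ℂ, inner_swap_swap]

theorem swap_ne_zero {a b : ℕ} {ψ : Bipartite a b} (h : ψ ≠ 0) : swap ψ ≠ 0 := by
  rw [← norm_ne_zero_iff] at h ⊢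
  rwa [norm_swap]

theorem actA_swap {a b b' : ℕ} (M : Matrix (Fin b') (Fin b) ℂ) (ψ : Bipartite a b) :
    actA M (swap ψ) = swap (actB M ψ) := by
  ext ⟨i, j⟩
  simp only [actA_apply, swap_apply, actB_apply]

theorem actB_swap {a a' b : ℕ} (M : Matrix (Fin a') (Fin a) ℂ) (ψ : Bipartite a b) :
    actB M (swap ψ) = swap (actA M ψ) := by
  ext ⟨i, j⟩
  simp only [actA_apply, swap_apply, actB_apply]

theorem IsProduct.swap {a b : ℕ} {ψ : Bipartite a b} (h : IsProduct ψ) :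
    IsProduct (swap ψ) := by
  obtain ⟨u, v, huv⟩ := h
  exact ⟨v, u, fun i j => by rw [swap_apply, huv, mul_comm]⟩

theorem IsEntangled.swap {a b : ℕ} {ψ : Bipartite a b} (h : IsEntangled ψ) :
    IsEntangled (swap ψ) := fun h' => h h'.swap

/-- The protocol with the roles of Alice and Bob exchanged. -/
def LOCCProtocol.swap {L : Type} : {a b : ℕ} → LOCCProtocol L a b → LOCCProtocol L b a
  | _, _, .announce g => .announce g
  | _, _, .alice m next => .bob m fun x => (next x).swap
  | _, _, .bob m next => .alice m fun x => (next x).swap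

theorem LOCCProtocol.weight_swap {L : Type} {a b : ℕ} (P : LOCCProtocol L a b) :
    ∀ (ψ : Bipartite a b) (g : L), P.swap.weight (TwoQubit.swap ψ) g = P.weight ψ g := by
  induction P with
  | announce g' =>
    intro ψ g
    simp only [LOCCProtocol.swap, LOCCProtocol.weight, norm_swap]
  | alice m next ih =>
    intro ψ g
    simp only [LOCCProtocol.swap, LOCCProtocol.weight, actB_swap, ih]
  | bob m next ih =>
    intro ψ g
    simp only [LOCCProtocol.swap, LOCCProtocol.weight, actA_swap, ih]

/-- The family `w` of vectors, labelled by `L`, can be distinguished perfectly by LOCC, if the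
label is known to be in `T`. -/
def Discriminable {L : Type} {a b : ℕ} (T : Set L) (w : L → Bipartite a b) : Prop :=
  ∃ P : LOCCProtocol L a b, ∀ l ∈ T, P.weight (w l) l = ‖w l‖ ^ 2

theorem Discriminable.of_swap {L : Type} {a b : ℕ} {T : Set L} {w : L → Bipartite a b}
    (h : Discriminable T fun l => swap (w l)) : Discriminable T w := by
  obtain ⟨P, hP⟩ := h
  refine ⟨P.swap, fun l hl => ?_⟩
  have := P.weight_swap (swap (w l)) l
  rw [swap_swap] at this
  rw [this, hP l hl, norm_swap]

/-! ### Measurements in an orthonormal basis -/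

/-- The row matrix `⟨u|`. -/
def bra {d : ℕ} (u : EuclideanSpace ℂ (Fin d)) : Matrix (Fin 1) (Fin d) ℂ :=
  Matrix.of fun _ k => star (u k)

theorem sum_conjTranspose_bra_mul_bra {d : ℕ}
    (e : OrthonormalBasis (Fin d) ℂ (EuclideanSpace ℂ (Fin d))) :
    ∑ x, (bra (e x))ᴴ * bra (e x) = 1 := by
  ext i j
  have h := e.sum_inner_mul_inner (EuclideanSpace.single i 1) (EuclideanSpace.single j 1)
  simpa [Matrix.sum_apply, mul_apply, bra, Matrix.one_apply, EuclideanSpace.inner_single_left,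
    EuclideanSpace.inner_single_right, Pi.single_apply, eq_comm] using h

/-- The projective measurement in the orthonormal basis `e`. Only the classical outcome is kept,
so the system afterwards is one-dimensional. -/
noncomputable def basisMeasurement {d : ℕ}
    (e : OrthonormalBasis (Fin d) ℂ (EuclideanSpace ℂ (Fin d))) : Measurement d where
  numOutcomes := d
  outDim _ := 1
  op x := bra (e x)
  complete := sum_conjTranspose_bra_mul_bra e

theorem bra_smul {d : ℕ} (c : ℂ) (u : EuclideanSpace ℂ (Fin d)) :
    bra (c • u) = star c • bra u := by
  ext i j
  simp [bra]

/-- Up to normalization, every nonzero vector is the first vector of an orthonormal basis. -/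
theorem exists_orthonormalBasis_smul {u : EuclideanSpace ℂ (Fin 2)} (hu : u ≠ 0) :
    ∃ (e : OrthonormalBasis (Fin 2) ℂ (EuclideanSpace ℂ (Fin 2))) (c : ℂ),
      c ≠ 0 ∧ e 0 = c • u := by
  have hc : ((‖u‖⁻¹ : ℝ) : ℂ) ≠ 0 := by simpa using hu
  have ho : Orthonormal ℂ (({0} : Set (Fin 2)).domRestrict fun _ => ((‖u‖⁻¹ : ℝ) : ℂ) • u) := by
    rw [orthonormal_iff_ite]
    rintro ⟨i, hi⟩ ⟨j, hj⟩
    obtain rfl : i = 0 := hi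
    obtain rfl : j = 0 := hj
    have hn : ‖((‖u‖⁻¹ : ℝ) : ℂ) • u‖ = 1 := by
      rw [norm_smul, Complex.norm_real, norm_inv, norm_norm,
        inv_mul_cancel₀ (norm_ne_zero_iff.2 hu)]
    rw [if_pos rfl]
    change inner ℂ (((‖u‖⁻¹ : ℝ) : ℂ) • u) (((‖u‖⁻¹ : ℝ) : ℂ) • u) = 1
    rw [inner_self_eq_norm_sq_to_K, hn]
    simp
  obtain ⟨e, he⟩ := ho.exists_orthonormalBasis_extension_of_card_eq (by simp)
  exact ⟨e, _, hc, he 0 rfl⟩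

/-- In two dimensions only two nonzero vectors can be orthogonal to each other. -/
theorem eq_zero_of_inner_eq_zero {E : Type*} [NormedAddCommGroup E] [InnerProductSpace ℂ E]
    (hE : Module.finrank ℂ E = 2) {x y z : E} (hx : x ≠ 0) (hy : y ≠ 0)
    (hxy : inner ℂ x y = 0) (hxz : inner ℂ x z = 0) (hyz : inner ℂ y z = 0) : z = 0 := by
  by_contra hz
  have : FiniteDimensional ℂ E := Module.finite_of_finrank_eq_succ hE
  have hli : LinearIndependent ℂ ![x, y, z] := by
    refine linearIndependent_of_ne_zero_of_inner_eq_zero ?_ ?_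
    · intro i
      fin_cases i <;> assumption
    · intro i j hij
      fin_cases i <;> fin_cases j <;> first
        | exact absurd rfl hij
        | assumption
        | (apply inner_eq_zero_symm.1; assumption)
  have := hli.fintype_card_le_finrank
  rw [hE] at this
  simp at this

/-- In two dimensions the orthogonal complement of a nonzero vector is a line. -/
theorem exists_eq_smul_of_inner_eq_zero {E : Type*} [NormedAddCommGroup E]
    [InnerProductSpace ℂ E] (hE : Module.finrank ℂ E = 2) {x y z : E} (hx : x ≠ 0) (hz : z ≠ 0)
    (hzx : inner ℂ z x = 0) (hzy : inner ℂ z y = 0) : ∃ c : ℂ, y = c • x := by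
  refine ⟨inner ℂ x y / inner ℂ x x, sub_eq_zero.1 ?_⟩
  refine eq_zero_of_inner_eq_zero hE hz hx hzx ?_ ?_
  · rw [inner_sub_right, inner_smul_right, hzx, hzy]
    simp
  · rw [inner_sub_right, inner_smul_right, div_mul_cancel₀ _ (inner_self_ne_zero.2 hx), sub_self]

/-! ### Sufficient conditions for discrimination -/

/-- If Alice's system is one-dimensional, Bob distinguishes orthogonal vectors: he measures in an
orthonormal basis that contains, up to normalization, the at most two nonzero ones. -/
theorem discriminable_of_pairwise_inner_eq_zero {L : Type} [Nonempty L] {T : Set L}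
    {w : L → Bipartite 1 2} (hw : ∀ l ∈ T, ∀ l' ∈ T, l ≠ l' → inner ℂ (w l) (w l') = 0) :
    Discriminable T w := by
  classical
  by_cases hz : ∀ l ∈ T, w l = 0
  · refine ⟨.announce (Classical.arbitrary L), fun l hl => ?_⟩
    simp [LOCCProtocol.weight, hz l hl]
  push Not at hz
  obtain ⟨l₀, hl₀, hne⟩ := hz
  -- the vector `w l₀` of Bob's system, as a Euclidean vector
  let r : Bipartite 1 2 → EuclideanSpace ℂ (Fin 2) := fun ψ => WithLp.toLp 2 fun k => ψ (0, k)
  have hr : ∀ ψ φ, inner ℂ (r ψ) (r φ) = inner ℂ ψ φ := by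
    intro ψ φ
    rw [inner_eq_sum]
    simp [r, PiLp.inner_apply, mul_comm]
  have hr0 : r (w l₀) ≠ 0 := by
    rw [← inner_self_ne_zero (𝕜 := ℂ), hr]
    exact inner_self_ne_zero.2 hne
  obtain ⟨e, c, hc, he⟩ := exists_orthonormalBasis_smul hr0
  have hact : ∀ x ψ, actB (bra (e x)) ψ = 0 ↔ inner ℂ (e x) (r ψ) = 0 := by
    intro x ψ
    rw [← norm_eq_zero, EuclideanSpace.norm_eq]
    simp [Fintype.sum_prod_type, actB_apply, bra, r, PiLp.inner_apply, mul_comm]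
  have h0 : ∀ l ∈ T, l ≠ l₀ → actB (bra (e 0)) (w l) = 0 := by
    intro l hl hne'
    rw [hact, he, inner_smul_left, hr, hw l₀ hl₀ l hl hne'.symm, mul_zero]
  have h1 : actB (bra (e 1)) (w l₀) = 0 := by
    have h10 : inner ℂ (e 1) (e 0) = 0 := e.orthonormal.2 (by decide)
    rw [hact]
    rw [he, inner_smul_right] at h10
    exact (mul_eq_zero.1 h10).resolve_left hc
  -- at most one further vector is nonzero
  obtain ⟨l₁, hl₁⟩ : ∃ l₁, ∀ l ∈ T, l ≠ l₀ → l ≠ l₁ → w l = 0 := by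
    by_cases h : ∃ l₁ ∈ T, l₁ ≠ l₀ ∧ w l₁ ≠ 0
    · obtain ⟨l₁, hT, h10, hw1⟩ := h
      refine ⟨l₁, fun l hl h l' => ?_⟩
      exact eq_zero_of_inner_eq_zero (by simp) hne hw1 (hw _ hl₀ _ hT h10.symm)
        (hw _ hl₀ _ hl h.symm) (hw _ hT _ hl l'.symm)
    · push Not at h
      exact ⟨l₀, fun l hl h0 _ => h l hl h0⟩
  refine ⟨.bob (basisMeasurement e)
    fun x => .announce (if (show Fin 2 from x) = 0 then l₀ else l₁), fun l hl => ?_⟩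
  rw [LOCCProtocol.weight_bob_eq_iff]
  change ∀ x : Fin 2, LOCCProtocol.weight _ (actB (bra (e x)) (w l)) l
    = ‖actB (bra (e x)) (w l)‖ ^ 2
  intro x
  simp only [LOCCProtocol.weight]
  by_cases hll : l = l₀
  · subst hll
    fin_cases x
    · simp
    · simp [h1]
  · by_cases hll1 : l = l₁
    · subst hll1
      fin_cases x
      · simp [h0 l hl hll]
      · simp
    · rw [hl₁ l hl hll hll1]
      simp [actB]

/-- It suffices that the vectors stay orthogonal after one outcome of a projective measurement by
Alice: their inner products before the measurement are the sums over both outcomes, so that they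
stay orthogonal after the other outcome too. Then Bob can finish. -/
theorem discriminable_of_bra {L : Type} [Nonempty L] {T : Set L} {w : L → Bipartite 2 2}
    (hw : ∀ l ∈ T, ∀ l' ∈ T, l ≠ l' → inner ℂ (w l) (w l') = 0)
    {u : EuclideanSpace ℂ (Fin 2)} (hu : u ≠ 0)
    (h : ∀ l ∈ T, ∀ l' ∈ T, l ≠ l' →
      inner ℂ (actA (bra u) (w l)) (actA (bra u) (w l')) = 0) :
    Discriminable T w := by
  obtain ⟨e, c, -, he⟩ := exists_orthonormalBasis_smul hu
  have h0 : ∀ l ∈ T, ∀ l' ∈ T, l ≠ l' →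
      inner ℂ (actA (bra (e 0)) (w l)) (actA (bra (e 0)) (w l')) = 0 := by
    intro l hl l' hl' hne
    rw [he, bra_smul, actA_smul, actA_smul, inner_smul_left, inner_smul_right,
      h l hl l' hl' hne]
    simp
  have hx : ∀ x : Fin 2, ∀ l ∈ T, ∀ l' ∈ T, l ≠ l' →
      inner ℂ (actA (bra (e x)) (w l)) (actA (bra (e x)) (w l')) = 0 := by
    intro x l hl l' hl' hne
    have hs := (basisMeasurement e).sum_inner_actA (w l) (w l')
    change ∑ x : Fin 2, inner ℂ (actA (bra (e x)) (w l)) (actA (bra (e x)) (w l')) = _ at hs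
    rw [Fin.sum_univ_two, h0 l hl l' hl' hne, hw l hl l' hl' hne, zero_add] at hs
    fin_cases x
    · exact h0 l hl l' hl' hne
    · exact hs
  choose P hP using fun x : Fin 2 => discriminable_of_pairwise_inner_eq_zero (hx x)
  refine ⟨.alice (basisMeasurement e) P, fun l hl => ?_⟩
  exact (LOCCProtocol.weight_alice_eq_iff (basisMeasurement e) P (w l) l).2 fun x => hP x l hl

/-! ### Two orthogonal states -/

/-- The numerical range of a traceless `2 × 2` matrix contains `0`. In terms of the Bloch vector
`(n₁, n₂, n₃)` of the pure state to be found, the complex equation becomes two real linear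
equations in three unknowns. -/
theorem exists_quadratic_form_eq_zero (A B C : ℂ) : ∃ x y : ℂ, (x ≠ 0 ∨ y ≠ 0) ∧
    A * (x * star x - y * star y) + B * (x * star y) + C * (y * star x) = 0 := by
  let F : (Fin 3 → ℝ) →ₗ[ℝ] ℂ :=
    { toFun := fun n => 2 * A * n 2 + B * (n 0 + n 1 * Complex.I) + C * (n 0 - n 1 * Complex.I)
      map_add' := fun n n' => by
        simp only [Pi.add_apply, Complex.ofReal_add]
        ring
      map_smul' := fun t n => by
        simp only [Pi.smul_apply, smul_eq_mul, Complex.ofReal_mul, Complex.real_smul,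
          RingHom.id_apply]
        ring }
  obtain ⟨n, hn, hn0⟩ := (Submodule.ne_bot_iff _).1 <|
    F.ker_ne_bot_of_finrank_lt (by simp [Complex.finrank_real_complex])
  replace hn : 2 * A * n 2 + B * (n 0 + n 1 * Complex.I) + C * (n 0 - n 1 * Complex.I) = 0 := hn
  set N : ℝ := Real.sqrt (n 0 ^ 2 + n 1 ^ 2 + n 2 ^ 2) with hN
  have hN2 : N ^ 2 = n 0 ^ 2 + n 1 ^ 2 + n 2 ^ 2 := Real.sq_sqrt (by positivity)
  have hI : Complex.I ^ 2 = -1 := Complex.I_sq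
  have hNC : (N : ℂ) ^ 2 = n 0 ^ 2 + n 1 ^ 2 + n 2 ^ 2 := by exact_mod_cast hN2
  by_cases h : n 0 = 0 ∧ n 1 = 0
  · -- the Bloch vector is vertical, and the state is a basis vector
    have h2 : n 2 ≠ 0 := by
      intro h2
      apply hn0
      funext i
      fin_cases i
      exacts [h.1, h.2, h2]
    have hA : A = 0 := by
      simpa [h.1, h.2, h2] using hn
    exact ⟨0, 1, Or.inr one_ne_zero, by simp [hA]⟩
  · refine ⟨n 2 + N, n 0 - n 1 * Complex.I, Or.inr ?_, ?_⟩
    · intro h0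
      apply h
      have hre := congrArg Complex.re h0
      have him := congrArg Complex.im h0
      simp only [Complex.sub_re, Complex.ofReal_re, Complex.re_ofReal_mul, Complex.I_re, mul_zero,
        sub_zero, Complex.zero_re] at hre
      simp only [Complex.sub_im, Complex.ofReal_im, Complex.im_ofReal_mul, Complex.I_im, mul_one,
        zero_sub, Complex.zero_im, neg_eq_zero] at him
      exact ⟨hre, him⟩
    · simp only [Complex.star_def, map_add, map_sub, map_mul, Complex.conj_ofReal,
        Complex.conj_I]
      linear_combination ((n 2 : ℂ) + N) * hn + A * hNC + A * (n 1 : ℂ) ^ 2 * hI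

/-- For two orthogonal vectors there is a state of Alice's system such that projecting onto it
keeps them orthogonal (Walgate, Short, Hardy and Vedral). -/
theorem exists_bra_inner_eq_zero {ψ φ : Bipartite 2 2} (h : inner ℂ ψ φ = 0) :
    ∃ u : EuclideanSpace ℂ (Fin 2), u ≠ 0 ∧
      inner ℂ (actA (bra u) ψ) (actA (bra u) φ) = 0 := by
  obtain ⟨x, y, hxy, hq⟩ := exists_quadratic_form_eq_zero
    (∑ j, star (ψ (0, j)) * φ (0, j)) (∑ j, star (ψ (0, j)) * φ (1, j))
    (∑ j, star (ψ (1, j)) * φ (0, j))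
  refine ⟨!₂[x, y], ?_, ?_⟩
  · intro h0
    have hx := congrFun (congrArg WithLp.ofLp h0) 0
    have hy := congrFun (congrArg WithLp.ofLp h0) 1
    simp at hx hy
    exact hxy.elim (fun hx' => hx' hx) fun hy' => hy' hy
  · rw [inner_eq_sum] at h ⊢
    simp [actA_apply, bra, Fin.sum_univ_two] at h hq ⊢
    linear_combination hq + y * (starRingEnd ℂ) y * h

/-! ### Orthogonal states with at most one entangled -/

/-- The product vector `|u⟩ ⊗ |v⟩`. -/
noncomputable def tensor {a b : ℕ} (u : EuclideanSpace ℂ (Fin a)) (v : EuclideanSpace ℂ (Fin b)) :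
    Bipartite a b :=
  WithLp.toLp 2 fun p => u p.1 * v p.2

theorem IsProduct.exists_eq_tensor {a b : ℕ} {ψ : Bipartite a b} (h : IsProduct ψ) :
    ∃ u v, ψ = tensor u v := by
  obtain ⟨u, v, h⟩ := h
  exact ⟨u, v, by ext ⟨i, j⟩; exact h i j⟩

theorem tensor_ne_zero {a b : ℕ} {u : EuclideanSpace ℂ (Fin a)} {v : EuclideanSpace ℂ (Fin b)}
    (h : tensor u v ≠ 0) : u ≠ 0 ∧ v ≠ 0 := by
  constructor <;> rintro rfl <;> apply h <;> ext <;> simp [tensor]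

theorem swap_tensor {a b : ℕ} (u : EuclideanSpace ℂ (Fin a)) (v : EuclideanSpace ℂ (Fin b)) :
    swap (tensor u v) = tensor v u := by
  ext ⟨i, j⟩
  exact mul_comm _ _

theorem smul_tensor {a b : ℕ} (c : ℂ) (u : EuclideanSpace ℂ (Fin a))
    (v : EuclideanSpace ℂ (Fin b)) : tensor (c • u) v = c • tensor u v := by
  ext ⟨i, j⟩
  simp [tensor, mul_assoc]

theorem tensor_smul {a b : ℕ} (c : ℂ) (u : EuclideanSpace ℂ (Fin a))
    (v : EuclideanSpace ℂ (Fin b)) : tensor u (c • v) = c • tensor u v := by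
  ext ⟨i, j⟩
  simp [tensor, mul_left_comm]

theorem inner_tensor_tensor {a b : ℕ} (u u' : EuclideanSpace ℂ (Fin a))
    (v v' : EuclideanSpace ℂ (Fin b)) :
    inner ℂ (tensor u v) (tensor u' v') = inner ℂ u u' * inner ℂ v v' := by
  rw [inner_eq_sum]
  simp only [tensor, PiLp.inner_apply, Finset.sum_mul_sum]
  refine Finset.sum_congr rfl fun i _ => Finset.sum_congr rfl fun j _ => ?_
  simp only [RCLike.inner_apply, star_mul', Complex.star_def]
  ring

theorem inner_tensor_single_actA_bra {a b : ℕ} (u : EuclideanSpace ℂ (Fin a))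
    (y : EuclideanSpace ℂ (Fin b)) (φ : Bipartite a b) :
    inner ℂ (tensor (EuclideanSpace.single 0 1) y) (actA (bra u) φ) = inner ℂ (tensor u y) φ := by
  simp only [inner_eq_sum, Fintype.sum_unique, actA_apply, tensor, bra, Matrix.of_apply,
    Finset.mul_sum]
  rw [Finset.sum_comm]
  refine Finset.sum_congr rfl fun i _ => Finset.sum_congr rfl fun j _ => ?_
  simp
  ring

theorem actA_bra_tensor {a b : ℕ} (u x : EuclideanSpace ℂ (Fin a))
    (y : EuclideanSpace ℂ (Fin b)) :
    actA (bra u) (tensor x y) = inner ℂ u x • tensor (EuclideanSpace.single 0 1) y := by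
  ext ⟨i, j⟩
  obtain rfl := Subsingleton.elim i 0
  simp only [actA_apply, tensor, bra, Matrix.of_apply, PiLp.smul_apply, smul_eq_mul,
    PiLp.inner_apply, Finset.sum_mul]
  refine Finset.sum_congr rfl fun k _ => ?_
  simp
  ring

theorem inner_actA_bra_tensor {a b : ℕ} (u x : EuclideanSpace ℂ (Fin a))
    (y : EuclideanSpace ℂ (Fin b)) (φ : Bipartite a b) :
    inner ℂ (actA (bra u) (tensor x y)) (actA (bra u) φ)
      = star (inner ℂ u x) * inner ℂ (tensor u y) φ := by
  rw [actA_bra_tensor, inner_smul_left, inner_tensor_single_actA_bra, Complex.star_def]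

/-- A vector orthogonal to `u₁ ⊗ v` and `u₂ ⊗ v`, for a basis `u₁, u₂`, vanishes when Bob finds
`v`. -/
theorem actA_bra_swap_eq_zero {b : ℕ} {u₁ u₂ : EuclideanSpace ℂ (Fin 2)}
    {v : EuclideanSpace ℂ (Fin b)} (hu₁ : u₁ ≠ 0) (hu₂ : u₂ ≠ 0) (hu : inner ℂ u₁ u₂ = 0)
    {φ : Bipartite 2 b} (h₁ : inner ℂ (tensor u₁ v) φ = 0) (h₂ : inner ℂ (tensor u₂ v) φ = 0) :
    actA (bra v) (swap φ) = 0 := by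
  have hne : ∀ u : EuclideanSpace ℂ (Fin 2), u ≠ 0 →
      (tensor (EuclideanSpace.single 0 1) u : Bipartite 1 2) ≠ 0 := by
    intro u hu h
    rw [← inner_self_eq_zero (𝕜 := ℂ), inner_tensor_tensor] at h
    simp [hu] at h
  refine eq_zero_of_inner_eq_zero (by simp) (hne u₁ hu₁) (hne u₂ hu₂) ?_ ?_ ?_
  · rw [inner_tensor_tensor, hu, mul_zero]
  · rw [inner_tensor_single_actA_bra, ← swap_tensor, inner_swap_swap, h₁]
  · rw [inner_tensor_single_actA_bra, ← swap_tensor, inner_swap_swap, h₂]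

/-- Let `u₁ ⊗ v₁` and `u₂ ⊗ v₂` with `u₁ ⊥ u₂` be among the states. Either Alice can start with
the basis `u₁, u₂`, or some product state `u₃ ⊗ v₃` loses orthogonality to another state. In the
latter case `u₃` is neither proportional to `u₁` nor to `u₂`, so that `v₃` is orthogonal to `v₁`
and `v₂`, and Bob can start with the basis `v₁, v₃`. -/
theorem discriminable_of_tensor_of_inner_eq_zero {L : Type} {T : Set L} {w : L → Bipartite 2 2}
    (hw0 : ∀ l ∈ T, w l ≠ 0) (hw : ∀ l ∈ T, ∀ l' ∈ T, l ≠ l' → inner ℂ (w l) (w l') = 0)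
    (hprod : ∀ l ∈ T, ∀ l' ∈ T, l ≠ l' → IsProduct (w l) ∨ IsProduct (w l'))
    {l₁ l₂ : L} (hl₁ : l₁ ∈ T) (hl₂ : l₂ ∈ T) (hne : l₁ ≠ l₂)
    {u₁ u₂ v₁ v₂ : EuclideanSpace ℂ (Fin 2)} (h₁ : w l₁ = tensor u₁ v₁)
    (h₂ : w l₂ = tensor u₂ v₂) (hu : inner ℂ u₁ u₂ = 0) : Discriminable T w := by
  have : Nonempty L := ⟨l₁⟩
  have hfin : Module.finrank ℂ (EuclideanSpace ℂ (Fin 2)) = 2 := by simp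
  obtain ⟨hu₁, hv₁⟩ := tensor_ne_zero (h₁ ▸ hw0 l₁ hl₁)
  obtain ⟨hu₂, hv₂⟩ := tensor_ne_zero (h₂ ▸ hw0 l₂ hl₂)
  -- Alice's outcome `u₁` does not affect the orthogonality to the two given states
  have hA₁ : ∀ l ∈ T, l ≠ l₁ → inner ℂ (actA (bra u₁) (w l₁)) (actA (bra u₁) (w l)) = 0 := by
    intro l hl hll
    rw [h₁, inner_actA_bra_tensor, ← h₁, hw l₁ hl₁ l hl hll.symm, mul_zero]
  have hA₂ : actA (bra u₁) (w l₂) = 0 := by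
    rw [h₂, actA_bra_tensor, hu, zero_smul]
  have key : ∀ l ∈ T, ∀ l' ∈ T, l ≠ l' → IsProduct (w l) →
      inner ℂ (actA (bra u₁) (w l)) (actA (bra u₁) (w l')) ≠ 0 → Discriminable T w := by
    intro l hl l' hl' hll hp hin
    have hl1 : l ≠ l₁ := by
      rintro rfl
      exact hin (hA₁ l' hl' hll.symm)
    have hl2 : l ≠ l₂ := by
      rintro rfl
      exact hin (by rw [hA₂, inner_zero_left])
    obtain ⟨u₃, v₃, h₃⟩ := hp.exists_eq_tensor
    obtain ⟨hu₃, hv₃⟩ := tensor_ne_zero (h₃ ▸ hw0 l hl)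
    have h13 : inner ℂ u₁ u₃ ≠ 0 := by
      intro h
      exact hin (by rw [h₃, inner_actA_bra_tensor, h, star_zero, zero_mul])
    have h23 : inner ℂ u₂ u₃ ≠ 0 := by
      intro h
      obtain ⟨c, hc⟩ := exists_eq_smul_of_inner_eq_zero hfin hu₁ hu₂ (inner_eq_zero_symm.1 hu) h
      have hc0 : c ≠ 0 := by
        rintro rfl
        exact hu₃ (by rw [hc, zero_smul])
      have h0 := hw l hl l' hl' hll
      rw [h₃, hc, smul_tensor, inner_smul_left] at h0
      have h0' := (mul_eq_zero.1 h0).resolve_left (by simpa using hc0)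
      exact hin (by rw [h₃, inner_actA_bra_tensor, h0', mul_zero])
    have hv13 : inner ℂ v₁ v₃ = 0 := by
      have h0 := hw l₁ hl₁ l hl hl1.symm
      rw [h₁, h₃, inner_tensor_tensor] at h0
      exact (mul_eq_zero.1 h0).resolve_left h13
    have hv23 : inner ℂ v₂ v₃ = 0 := by
      have h0 := hw l₂ hl₂ l hl hl2.symm
      rw [h₂, h₃, inner_tensor_tensor] at h0
      exact (mul_eq_zero.1 h0).resolve_left h23
    obtain ⟨c, hc⟩ := exists_eq_smul_of_inner_eq_zero hfin hv₁ hv₃ (inner_eq_zero_symm.1 hv13)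
      (inner_eq_zero_symm.1 hv23)
    have hc0 : c ≠ 0 := by
      rintro rfl
      exact hv₂ (by rw [hc, zero_smul])
    -- Bob's outcome `v₁` annihilates all states other than the two given ones
    have hB : ∀ m ∈ T, m ≠ l₁ → m ≠ l₂ → actA (bra v₁) (swap (w m)) = 0 := by
      intro m hm hm1 hm2
      refine actA_bra_swap_eq_zero hu₁ hu₂ hu ?_ ?_
      · rw [← h₁, hw l₁ hl₁ m hm hm1.symm]
      · have h0 := hw l₂ hl₂ m hm hm2.symm
        rw [h₂, hc, tensor_smul, inner_smul_left] at h0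
        exact (mul_eq_zero.1 h0).resolve_left (by simpa using hc0)
    have h12 : inner ℂ (actA (bra v₁) (swap (w l₁))) (actA (bra v₁) (swap (w l₂))) = 0 := by
      rw [h₁, h₂, swap_tensor, swap_tensor, inner_actA_bra_tensor, inner_tensor_tensor, hu]
      simp
    refine Discriminable.of_swap (discriminable_of_bra ?_ hv₁ ?_)
    · intro m hm m' hm' hmm
      rw [inner_swap_swap, hw m hm m' hm' hmm]
    · intro m hm m' hm' hmm
      by_cases hm1 : m = l₁
      · subst hm1
        by_cases hm2 : m' = l₂
        · rw [hm2, h12]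
        · rw [hB m' hm' hmm.symm hm2, inner_zero_right]
      · by_cases hm2 : m = l₂
        · subst hm2
          by_cases hm1' : m' = l₁
          · rw [hm1', inner_eq_zero_symm, h12]
          · rw [hB m' hm' hm1' hmm.symm, inner_zero_right]
        · rw [hB m hm hm1 hm2, inner_zero_left]
  by_contra hcon
  refine hcon (discriminable_of_bra hw hu₁ fun l hl l' hl' hll => ?_)
  by_contra hin
  rcases hprod l hl l' hl' hll with hp | hp
  · exact hcon (key l hl l' hl' hll hp hin)
  · exact hcon (key l' hl' l hl hll.symm hp fun h => hin (inner_eq_zero_symm.1 h))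

/-- Orthogonal states at most one of which is entangled are locally distinguishable, if two of
them are product states. -/
theorem IsOrthogonalSet.locallyDistinguishable_of_isProduct {S : Set (Bipartite 2 2)}
    (hS : IsOrthogonalSet S)
    (hprod : ∀ ψ ∈ S, ∀ φ ∈ S, ψ ≠ φ → IsProduct ψ ∨ IsProduct φ)
    {ψ₁ ψ₂ : Bipartite 2 2} (hψ₁ : ψ₁ ∈ S) (hψ₂ : ψ₂ ∈ S) (hne : ψ₁ ≠ ψ₂)
    (hp₁ : IsProduct ψ₁) (hp₂ : IsProduct ψ₂) : LocallyDistinguishable S := by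
  obtain ⟨u₁, v₁, h₁⟩ := hp₁.exists_eq_tensor
  obtain ⟨u₂, v₂, h₂⟩ := hp₂.exists_eq_tensor
  have h := hS.2 ψ₁ hψ₁ ψ₂ hψ₂ hne
  rw [h₁, h₂, inner_tensor_tensor, mul_eq_zero] at h
  change Discriminable S id
  rcases h with h | h
  · exact discriminable_of_tensor_of_inner_eq_zero hS.1 hS.2 hprod hψ₁ hψ₂ hne h₁ h₂ h
  · refine Discriminable.of_swap (discriminable_of_tensor_of_inner_eq_zero
      (fun ψ hψ => swap_ne_zero (hS.1 ψ hψ)) (fun ψ hψ φ hφ hψφ => ?_)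
      (fun ψ hψ φ hφ hψφ => (hprod ψ hψ φ hφ hψφ).imp IsProduct.swap IsProduct.swap)
      hψ₁ hψ₂ hne (v₁ := u₁) (v₂ := u₂) ?_ ?_ h)
    · exact (inner_swap_swap ψ φ).trans (hS.2 ψ hψ φ hφ hψφ)
    · rw [id, h₁, swap_tensor]
    · rw [id, h₂, swap_tensor]

theorem IsOrthogonalSet.locallyDistinguishable_of_encard_le_two {S : Set (Bipartite 2 2)}
    (hS : IsOrthogonalSet S) (hcard : S.encard ≤ 2) : LocallyDistinguishable S := by
  obtain ⟨u, hu, h⟩ : ∃ u : EuclideanSpace ℂ (Fin 2), u ≠ 0 ∧ ∀ ψ ∈ S, ∀ φ ∈ S, ψ ≠ φ →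
      inner ℂ (actA (bra u) ψ) (actA (bra u) φ) = 0 := by
    rcases hcard.lt_or_eq with h | h
    · have hsub : S.Subsingleton := by
        rw [← Set.encard_le_one_iff_subsingleton]
        exact Order.le_of_lt_succ h
      refine ⟨EuclideanSpace.single 0 1, by simp, fun ψ hψ φ hφ hne => ?_⟩
      exact absurd (hsub hψ hφ) hne
    · obtain ⟨ψ, φ, hne, rfl⟩ := Set.encard_eq_two.1 h
      obtain ⟨u, hu, h0⟩ := exists_bra_inner_eq_zero (hS.2 ψ (by simp) φ (by simp) hne)
      refine ⟨u, hu, ?_⟩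
      rintro x (rfl | rfl) y (rfl | rfl) hxy
      · exact absurd rfl hxy
      · exact h0
      · exact inner_eq_zero_symm.1 h0
      · exact absurd rfl hxy
  exact discriminable_of_bra (w := id) hS.2 hu h

/-! ### Two entangled states and a third one -/

theorem eq_sum_actA_bra {a b : ℕ} (e : OrthonormalBasis (Fin a) ℂ (EuclideanSpace ℂ (Fin a)))
    (ψ : Bipartite a b) (i : Fin a) (j : Fin b) :
    ψ (i, j) = ∑ x, e x i * actA (bra (e x)) ψ (0, j) := by
  conv_lhs => rw [← actA_one ψ, ← sum_conjTranspose_bra_mul_bra e, actA_sum]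
  simp only [WithLp.ofLp_sum, Finset.sum_apply, actA_apply, mul_apply, Fintype.sum_unique,
    conjTranspose_apply, bra, Matrix.of_apply, star_star, Finset.mul_sum, mul_assoc]

/-- If an outcome of a projective measurement by Alice cannot occur, the state is a product. -/
theorem IsEntangled.actA_bra_ne_zero {b : ℕ} {ψ : Bipartite 2 b} (hψ : IsEntangled ψ)
    (e : OrthonormalBasis (Fin 2) ℂ (EuclideanSpace ℂ (Fin 2))) (x : Fin 2) :
    actA (bra (e x)) ψ ≠ 0 := by
  intro h
  refine hψ ⟨e (x + 1), WithLp.toLp 2 fun j => actA (bra (e (x + 1))) ψ (0, j), fun i j => ?_⟩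
  rw [eq_sum_actA_bra e ψ i j, Fin.sum_univ_two]
  fin_cases x <;> simp_all

/-- If an operator of Alice preserves the orthogonality of two entangled states and a third state,
its POVM element `E` is scalar. Otherwise the pairwise inner products of the states before and
after the measurement determine those in the two eigenspaces of `E`, which hence are zero. As the
entangled states have nonzero components in both eigenspaces, those of the third state vanish. -/
theorem exists_conjTranspose_mul_self_eq_smul_one {a : ℕ} {M : Matrix (Fin a) (Fin 2) ℂ}
    {ψ φ χ : Bipartite 2 2} (hψ : IsEntangled ψ) (hφ : IsEntangled φ) (hχ : χ ≠ 0)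
    (hψφ : inner ℂ ψ φ = 0) (hψχ : inner ℂ ψ χ = 0) (hφχ : inner ℂ φ χ = 0)
    (hMψφ : inner ℂ (actA M ψ) (actA M φ) = 0) (hMψχ : inner ℂ (actA M ψ) (actA M χ) = 0)
    (hMφχ : inner ℂ (actA M φ) (actA M χ) = 0) : ∃ c : ℂ, Mᴴ * M = c • 1 := by
  have hE : (Mᴴ * M).IsHermitian := isHermitian_conjTranspose_mul_self M
  set e := hE.eigenvectorBasis
  have heig : ∀ x, Mᴴ * M * (bra (e x))ᴴ = (hE.eigenvalues x : ℂ) • (bra (e x))ᴴ := by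
    intro x
    ext i j
    have h := congrFun (hE.mulVec_eigenvectorBasis x) i
    simpa [mul_apply, mulVec, dotProduct, bra] using h
  have hdec : Mᴴ * M = ∑ x, (hE.eigenvalues x : ℂ) • ((bra (e x))ᴴ * bra (e x)) := by
    conv_lhs => rw [← Matrix.mul_one (Mᴴ * M), ← sum_conjTranspose_bra_mul_bra e]
    rw [Matrix.mul_sum]
    refine Finset.sum_congr rfl fun x _ => ?_
    rw [← Matrix.mul_assoc, heig, Matrix.smul_mul]
  by_cases hev : hE.eigenvalues 0 = hE.eigenvalues 1
  · refine ⟨hE.eigenvalues 0, ?_⟩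
    refine hdec.trans ?_
    rw [← sum_conjTranspose_bra_mul_bra e, Fin.sum_univ_two, Fin.sum_univ_two, ← hev, smul_add]
  exfalso
  have key : ∀ {α β : Bipartite 2 2}, inner ℂ α β = 0 → inner ℂ (actA M α) (actA M β) = 0 →
      ∀ x, inner ℂ (actA (bra (e x)) α) (actA (bra (e x)) β) = 0 := by
    intro α β h hM
    rw [inner_actA, hdec, actA_sum, inner_sum, Fin.sum_univ_two] at hM
    rw [← actA_one β, ← sum_conjTranspose_bra_mul_bra e, actA_sum, inner_sum,
      Fin.sum_univ_two] at h
    simp only [actA_smul, inner_smul_right, ← inner_actA] at h hM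
    have hd : (hE.eigenvalues 0 : ℂ) - hE.eigenvalues 1 ≠ 0 := by
      rw [sub_ne_zero]
      exact_mod_cast hev
    rw [Fin.forall_fin_two]
    constructor
    · refine (mul_eq_zero.1 ?_).resolve_left hd
      linear_combination hM - (hE.eigenvalues 1 : ℂ) * h
    · refine (mul_eq_zero.1 ?_).resolve_left hd
      linear_combination (hE.eigenvalues 0 : ℂ) * h - hM
  have hz : ∀ x, actA (bra (e x)) χ = 0 := fun x =>
    eq_zero_of_inner_eq_zero (by simp) (hψ.actA_bra_ne_zero e x) (hφ.actA_bra_ne_zero e x)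
      (key hψφ hMψφ x) (key hψχ hMψχ x) (key hφχ hMφχ x)
  apply hχ
  ext ⟨i, j⟩
  rw [eq_sum_actA_bra e]
  simp [hz]

theorem IsOrthogonalSet.locallyStable {S : Set (Bipartite 2 2)} (hS : IsOrthogonalSet S)
    {ψ φ χ : Bipartite 2 2} (hψ : ψ ∈ S) (hφ : φ ∈ S) (hχ : χ ∈ S) (hψφ : ψ ≠ φ) (hψχ : ψ ≠ χ)
    (hφχ : φ ≠ χ) (hψe : IsEntangled ψ) (hφe : IsEntangled φ) : LocallyStable S := by
  constructor
  · intro m hm x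
    exact exists_conjTranspose_mul_self_eq_smul_one hψe hφe (hS.1 χ hχ)
      (hS.2 ψ hψ φ hφ hψφ) (hS.2 ψ hψ χ hχ hψχ) (hS.2 φ hφ χ hχ hφχ)
      (hm x ψ hψ φ hφ hψφ) (hm x ψ hψ χ hχ hψχ) (hm x φ hφ χ hχ hφχ)
  · intro m hm x
    have h : ∀ α ∈ S, ∀ β ∈ S, α ≠ β →
        inner ℂ (actA (m.op x) (swap α)) (actA (m.op x) (swap β)) = 0 := by
      intro α hα β hβ hne
      rw [actA_swap, actA_swap, inner_swap_swap, hm x α hα β hβ hne]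
    have h' : ∀ α ∈ S, ∀ β ∈ S, α ≠ β → inner ℂ (swap α) (swap β) = 0 := by
      intro α hα β hβ hne
      rw [inner_swap_swap, hS.2 α hα β hβ hne]
    exact exists_conjTranspose_mul_self_eq_smul_one hψe.swap hφe.swap (swap_ne_zero (hS.1 χ hχ))
      (h' ψ hψ φ hφ hψφ) (h' ψ hψ χ hχ hψχ) (h' φ hφ χ hχ hφχ)
      (h ψ hψ φ hφ hψφ) (h ψ hψ χ hχ hψχ) (h φ hφ χ hχ hφχ)

/-! ### The characterization -/

/-- A set with at most one element is not locally stable: every measurement preserves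
orthogonality, and a measurement in an orthonormal basis is not trivial. -/
theorem LocallyStable.nontrivial {b : ℕ} {S : Set (Bipartite 2 b)} (hS : LocallyStable S) :
    S.Nontrivial := by
  by_contra hnt
  rw [Set.not_nontrivial_iff] at hnt
  obtain ⟨c, hc⟩ := hS.1 (basisMeasurement (EuclideanSpace.basisFun (Fin 2) ℂ))
    (fun x ψ hψ φ hφ hne => absurd (hnt hψ hφ) hne) (0 : Fin 2)
  change (bra (EuclideanSpace.basisFun (Fin 2) ℂ 0))ᴴ * bra (EuclideanSpace.basisFun (Fin 2) ℂ 0)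
    = c • 1 at hc
  have h0 := congrFun (congrFun hc 0) 0
  have h1 := congrFun (congrFun hc 1) 1
  simp [mul_apply, bra] at h0 h1
  exact one_ne_zero (h0.trans h1.symm)

theorem IsOrthogonalSet.locallyStable_of_encard {S : Set (Bipartite 2 2)}
    (hS : IsOrthogonalSet S) (h3 : 3 ≤ S.encard)
    (h2 : 2 ≤ {ψ ∈ S | IsEntangled ψ}.encard) : LocallyStable S := by
  obtain ⟨ψ, φ, hψ, hφ, hne⟩ := Set.one_lt_encard_iff.1 (lt_of_lt_of_le (by norm_num) h2)
  obtain ⟨χ, hχ, hχ'⟩ : ∃ χ ∈ S, χ ∉ ({ψ, φ} : Set (Bipartite 2 2)) := by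
    by_contra! hcon
    have := (h3.trans (Set.encard_le_encard hcon)).trans_eq (Set.encard_pair hne)
    exact absurd this (by norm_num)
  simp only [Set.mem_insert_iff, Set.mem_singleton_iff, not_or] at hχ'
  exact hS.locallyStable hψ.1 hφ.1 hχ hne (Ne.symm hχ'.1) (Ne.symm hχ'.2) hψ.2 hφ.2

theorem IsOrthogonalSet.locallyDistinguishable_of_not_encard {S : Set (Bipartite 2 2)}
    (hS : IsOrthogonalSet S)
    (h : ¬ (3 ≤ S.encard ∧ 2 ≤ {ψ ∈ S | IsEntangled ψ}.encard)) : LocallyDistinguishable S := by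
  by_cases h3 : 3 ≤ S.encard
  · have hent : {ψ ∈ S | IsEntangled ψ}.Subsingleton := by
      rw [← Set.encard_le_one_iff_subsingleton]
      exact Order.le_of_lt_succ (not_le.1 fun h2 => h ⟨h3, h2⟩)
    have hprod : (S \ {ψ ∈ S | IsEntangled ψ}).Nontrivial := by
      rw [← Set.one_lt_encard_iff_nontrivial]
      by_contra! hcon
      have := Set.encard_sdiff_add_encard_of_subset (Set.sep_subset S IsEntangled)
      have h12 := add_le_add hcon (Set.encard_le_one_iff_subsingleton.2 hent)
      rw [this] at h12
      exact absurd (h3.trans h12) (by norm_num)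
    obtain ⟨ψ, hψ, φ, hφ, hne⟩ := hprod
    have hp : ∀ α ∈ S \ {ψ ∈ S | IsEntangled ψ}, IsProduct α := fun α hα =>
      not_not.1 fun h => hα.2 ⟨hα.1, h⟩
    refine hS.locallyDistinguishable_of_isProduct ?_ hψ.1 hφ.1 hne (hp ψ hψ) (hp φ hφ)
    intro α hα β hβ hαβ
    by_contra! hcon
    exact hαβ (hent ⟨hα, hcon.1⟩ ⟨hβ, hcon.2⟩)
  · exact hS.locallyDistinguishable_of_encard_le_two (Order.le_of_lt_succ (not_le.1 h3))

end TwoQubit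

theorem theorem1 (S : Set (TwoQubit.Bipartite 2 2)) (hS : TwoQubit.IsOrthogonalSet S) :
    (TwoQubit.LocallyStable S ↔ TwoQubit.LocallyIndistinguishable S) ∧
    (TwoQubit.LocallyStable S ↔
      3 ≤ S.encard ∧ 2 ≤ {ψ ∈ S | TwoQubit.IsEntangled ψ}.encard) := by
  have h₁ : TwoQubit.LocallyStable S → TwoQubit.LocallyIndistinguishable S := fun h =>
    h.locallyIndistinguishable hS.1 h.nontrivial
  have h₂ : TwoQubit.LocallyIndistinguishable S →
      3 ≤ S.encard ∧ 2 ≤ {ψ ∈ S | TwoQubit.IsEntangled ψ}.encard := fun h => by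
    by_contra hcon
    exact h (hS.locallyDistinguishable_of_not_encard hcon)
  have h₃ : (3 ≤ S.encard ∧ 2 ≤ {ψ ∈ S | TwoQubit.IsEntangled ψ}.encard) →
      TwoQubit.LocallyStable S := fun h => hS.locallyStable_of_encard h.1 h.2
  exact ⟨⟨h₁, h₃ ∘ h₂⟩, ⟨h₂ ∘ h₁, h₃⟩⟩
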